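/- Let $\mathcal X$ and $\mathcal C$ be two confocal ellipses (circles allowed) centred at the origin of the Euclidean plane, with common foci $\pm f$ and semi-major axes $s<t$ respectively ($\|f\|<s$), so that $\mathcal X$ lies inside $\mathcal C$. Let $m\ge 3$ and let $p_i$ ($i\in\mathbb Z/m$) be a Poncelet $m$-gon for this pair, i.e. the $p_i$ are $m$ distinct points of $\mathcal C$ and every line $\ell_i=p_i\vee p_{i+1}$ is tangent to $\mathcal X$ (the polygon may be a star polygon). Represent a point $q=(x,y)$ of the plane by the two antipodal points $\pm(x,y,1)/\|(x,y,1)\|$ of the unit sphere $S^2$, its positive and its negative representative. Choose homogeneous coordinates $w_i\in\mathbb R^3$ of $\ell_i$ for which $(0,0,1)$ is on the positive side, and put $H_i^{+}=\{v\in S^2: \langle w_i,v\rangle>0\}$ and $H_i^{-}=\{v\in S^2: \langle w_i,v\rangle<0\}$. For indices $a,b,c,d$ let $$\square^{a,b}_{c,d}=H_a^+\cap H_b^-\cap H_d^+\cap H_c^- .$$ Then for all $a,b,k\in\mathbb Z/m$ with $2k\neq 0$ and $2(b-a)\neq 0$ in $\mathbb Z/m$ (that is, neither $k$ nor $b-a$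 is $0$ or, for even $m$, $m/2$), the combinatorial square $\square^{a,b}_{a+k,b+k}$ has an incircle: there is a circle of positive radius in the Euclidean plane that is tangent to the lines $\ell_a,\ell_b,\ell_{a+k},\ell_{b+k}$ and such that either the positive representatives of all points of its interior lie in $\square^{a,b}_{a+k,b+k}$, or the negative representatives of all of them do. (If $b=a\pm k$, two of the four lines coincide, and the cell is bounded by three lines.) -/

import Mathlib

namespace PonceletGrid

/-- The Euclidean plane. -/
abbrev Plane : Type := EuclideanSpace ℝ (Fin 2)

/-- The space that contains the unit sphere of oriented homogeneous coordinates. -/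
abbrev Space : Type := EuclideanSpace ℝ (Fin 3)

/-- The ellipse with foci `f` and `-f` (hence with centre the origin) and semi-major axis `s`;
a genuine ellipse when `‖f‖ < s`. Two such ellipses with the same `f` are confocal. -/
def ellipse (f : Plane) (s : ℝ) : Set Plane :=
  {q | dist q f + dist q (-f) = 2 * s}

/-- A line is tangent to an ellipse `X` if it meets it in exactly one point. -/
def TangentToEllipse (X : Set Plane) (l : AffineSubspace ℝ Plane) : Prop :=
  ∃! q : Plane, q ∈ l ∧ q ∈ X

/-- The `i`-th side line of a polygon `p`: the join of the vertices `p i` and `p (i + 1)`. -/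
noncomputable def side {m : ℕ} (p : ZMod m → Plane) (i : ZMod m) : AffineSubspace ℝ Plane :=
  line[ℝ, p i, p (i + 1)]

/-- `p` is a Poncelet `m`-gon for the ellipses `X` and `C`: its `m` vertices (indexed modulo `m`)
are distinct points of `C` and its side lines are tangent to `X`.
No convexity is required: star polygons are allowed. -/
structure IsPonceletPolygon {m : ℕ} (X C : Set Plane) (p : ZMod m → Plane) : Prop where
  injective : Function.Injective p
  mem : ∀ i, p i ∈ C
  tangent : ∀ i, TangentToEllipse X (side p i)

/-- `w` is a vector of homogeneous coordinates of the line `l`, oriented such that the point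
`(0, 0, 1)`, which represents the origin of the plane, is on the positive side. -/
def IsOrientedCoord (l : AffineSubspace ℝ Plane) (w : Space) : Prop :=
  (∀ q : Plane, q ∈ l ↔ w 0 * q 0 + w 1 * q 1 + w 2 = 0) ∧ 0 < w 2

/-- The positive halfspace `H⁺` of the unit sphere that belongs to the oriented line `l`. -/
def posHalf (l : AffineSubspace ℝ Plane) : Set Space :=
  {v | v ∈ Metric.sphere (0 : Space) 1 ∧
    ∃ w, IsOrientedCoord l w ∧ 0 < w 0 * v 0 + w 1 * v 1 + w 2 * v 2}

/-- The negative halfspace `H⁻` of the unit sphere that belongs to the oriented line `l`. -/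
def negHalf (l : AffineSubspace ℝ Plane) : Set Space :=
  {v | v ∈ Metric.sphere (0 : Space) 1 ∧
    ∃ w, IsOrientedCoord l w ∧ w 0 * v 0 + w 1 * v 1 + w 2 * v 2 < 0}

/-- The double wedge `H_i⁺ ∩ H_j⁻`. -/
def doubleWedge {m : ℕ} (L : ZMod m → AffineSubspace ℝ Plane) (i j : ZMod m) : Set Space :=
  posHalf (L i) ∩ negHalf (L j)

/-- The cell with upper indices `a`, `b` and lower indices `c`, `d`: the intersection
`H_a⁺ ∩ H_b⁻ ∩ H_d⁺ ∩ H_c⁻` of two double wedges. -/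
def cell {m : ℕ} (L : ZMod m → AffineSubspace ℝ Plane) (a b c d : ZMod m) : Set Space :=
  doubleWedge L a b ∩ doubleWedge L d c

/-- The positive representative on the unit sphere of a point of the plane. -/
noncomputable def posRep (q : Plane) : Space :=
  ‖(!₂[q 0, q 1, 1] : Space)‖⁻¹ • (!₂[q 0, q 1, 1] : Space)

/-- The negative representative on the unit sphere of a point of the plane. -/
noncomputable def negRep (q : Plane) : Space := -posRep q

/-- The circle `S` is an incircle of the cell with indices `a`, `b`, `c`, `d`: it has positive
radius, its interior lies in the cell (all of it with positive sign or all of it with negative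
sign), and it is tangent to the lines with indices `a`, `b`, `c` and `d`. -/
def IsIncircle {m : ℕ} (L : ZMod m → AffineSubspace ℝ Plane) (a b c d : ZMod m)
    (S : EuclideanGeometry.Sphere Plane) : Prop :=
  0 < S.radius ∧
  ((∀ q ∈ Metric.ball S.center S.radius, posRep q ∈ cell L a b c d) ∨
    (∀ q ∈ Metric.ball S.center S.radius, negRep q ∈ cell L a b c d)) ∧
  S.IsTangent (L a) ∧ S.IsTangent (L b) ∧ S.IsTangent (L c) ∧ S.IsTangent (L d)

end PonceletGrid

namespace PonceletGrid

/-! In units of `s` and with axes along the foci, the inner ellipse is `x² + y²/(1 - k) = 1`, where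
`k` is its squared eccentricity. The line `cn · x + sn · y = dn` is tangent to it for every Jacobi
point. These points form an abelian group under the addition formulas, established here purely
algebraically. Two tangents that meet on a fixed confocal ellipse differ by an element determined up
to sign (`exists_half_sub_of_mem_confocal`). The sides of the polygon are distinct, so the sign
never flips and the sides form an arithmetic progression `u (i + n) = u i + n • w`
(`exists_translation`). The four lines thus have arguments `v`, `v + x`, `v + y`, `v + x + y`, that
is, `z ± α ± β` with `x = 2α` and `y = 2β`. By `contact_relation` there is a point, depending on `α`
and `β` only through `cn` and `dn`, whose signed distance to the tangent `z + α + β` is proportional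
to `sn α · sn β`. Flipping the sign of `α` or `β` keeps the point and flips the distance. The signs
therefore alternate as the cell requires, and the point is the incentre. -/

/-- A real point of the space curve `c² + s² = 1`, `d² + k s² = 1`, on the branch `d > 0`:
the values of the three Jacobi elliptic functions of parameter `k` at a real argument. -/
@[ext]
structure JacobiPoint (k : Set.Ico (0 : ℝ) 1) where
  cn : ℝ
  sn : ℝ
  dn : ℝ
  cn_sq : cn ^ 2 = 1 - sn ^ 2
  dn_sq : dn ^ 2 = 1 - k * sn ^ 2
  dn_pos : 0 < dn

/-! ### The group law on Jacobi points. -/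

namespace JacobiPoint

variable {k : Set.Ico (0 : ℝ) 1}

theorem sn_sq_le_one (u : JacobiPoint k) : u.sn ^ 2 ≤ 1 := by
  nlinarith [u.cn_sq, sq_nonneg u.cn]

/-- The denominator of the addition formulas. -/
noncomputable def denom (u v : JacobiPoint k) : ℝ := 1 - k * u.sn ^ 2 * v.sn ^ 2

theorem denom_pos (u v : JacobiPoint k) : 0 < denom u v := by
  have h : u.sn ^ 2 * v.sn ^ 2 ≤ 1 :=
    mul_le_one₀ u.sn_sq_le_one (sq_nonneg _) v.sn_sq_le_one
  have := k.2.1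
  have := k.2.2
  unfold denom
  nlinarith

theorem denom_ne (u v : JacobiPoint k) : denom u v ≠ 0 := (denom_pos u v).ne'

/-- Keeps sums on the branch `dn > 0`: since `k < 1`, `k · cn² = k - k · sn² < 1 - k · sn² = dn²`
for each argument. -/
theorem dn_addition_pos (u v : JacobiPoint k) :
    0 < u.dn * v.dn - k * u.sn * v.sn * u.cn * v.cn := by
  have hk := k.2.1
  have hk' := k.2.2
  have h : ((k : ℝ) * u.sn * v.sn * u.cn * v.cn) ^ 2 < (u.dn * v.dn) ^ 2 := by
    have hu := u.sn_sq_le_one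
    have hv := v.sn_sq_le_one
    have huv : u.sn ^ 2 * v.sn ^ 2 ≤ 1 := mul_le_one₀ hu (sq_nonneg _) hv
    calc ((k : ℝ) * u.sn * v.sn * u.cn * v.cn) ^ 2
        = (k * (1 - u.sn ^ 2)) * (k * (1 - v.sn ^ 2)) * (u.sn ^ 2 * v.sn ^ 2) := by
          rw [← u.cn_sq, ← v.cn_sq]; ring
      _ ≤ (k * (1 - u.sn ^ 2)) * (k * (1 - v.sn ^ 2)) :=
          mul_le_of_le_one_right (mul_nonneg (mul_nonneg hk (sub_nonneg.2 hu))
            (mul_nonneg hk (sub_nonneg.2 hv))) huv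
      _ < (1 - k * u.sn ^ 2) * (1 - k * v.sn ^ 2) :=
          mul_lt_mul'' (by linarith) (by linarith) (mul_nonneg hk (sub_nonneg.2 hu))
            (mul_nonneg hk (sub_nonneg.2 hv))
      _ = (u.dn * v.dn) ^ 2 := by rw [mul_pow, u.dn_sq, v.dn_sq]
  have := abs_lt_of_sq_lt_sq h (mul_pos u.dn_pos v.dn_pos).le
  linarith [(abs_lt.1 (this)).2, le_abs_self ((k : ℝ) * u.sn * v.sn * u.cn * v.cn)]

instance : Zero (JacobiPoint k) :=
  ⟨{ cn := 1, sn := 0, dn := 1, cn_sq := by norm_num, dn_sq := by norm_num,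
     dn_pos := one_pos }⟩

instance : Neg (JacobiPoint k) :=
  ⟨fun u => { cn := u.cn, sn := -u.sn, dn := u.dn, cn_sq := by rw [u.cn_sq, neg_sq],
              dn_sq := by rw [u.dn_sq, neg_sq], dn_pos := u.dn_pos }⟩

/-- Addition of arguments, by the addition formulas of the Jacobi elliptic functions. -/
noncomputable instance : Add (JacobiPoint k) :=
  ⟨fun u v =>
    { cn := (u.cn * v.cn - u.sn * v.sn * u.dn * v.dn) / denom u v
      sn := (u.sn * v.cn * v.dn + v.sn * u.cn * u.dn) / denom u v
      dn := (u.dn * v.dn - k * u.sn * v.sn * u.cn * v.cn) / denom u v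
      cn_sq := by
        have h := denom_ne u v
        have h1 := u.cn_sq
        have h2 := v.cn_sq
        have h3 := u.dn_sq
        have h4 := v.dn_sq
        rw [div_pow, div_pow, eq_sub_iff_add_eq, ← add_div, div_eq_one_iff_eq (pow_ne_zero 2 h),
          denom]
        grind
      dn_sq := by
        have h := denom_ne u v
        have h1 := u.cn_sq
        have h2 := v.cn_sq
        have h3 := u.dn_sq
        have h4 := v.dn_sq
        rw [div_pow, div_pow, eq_sub_iff_add_eq, ← mul_div_assoc, ← add_div,
          div_eq_one_iff_eq (pow_ne_zero 2 h), denom]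
        grind
      dn_pos := div_pos (dn_addition_pos u v) (denom_pos u v) }⟩

@[simp] theorem cn_zero : (0 : JacobiPoint k).cn = 1 := rfl
@[simp] theorem sn_zero : (0 : JacobiPoint k).sn = 0 := rfl
@[simp] theorem dn_zero : (0 : JacobiPoint k).dn = 1 := rfl
@[simp] theorem cn_neg (u : JacobiPoint k) : (-u).cn = u.cn := rfl
@[simp] theorem sn_neg (u : JacobiPoint k) : (-u).sn = -u.sn := rfl
@[simp] theorem dn_neg (u : JacobiPoint k) : (-u).dn = u.dn := rfl

theorem cn_add (u v : JacobiPoint k) :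
    (u + v).cn = (u.cn * v.cn - u.sn * v.sn * u.dn * v.dn) / denom u v := rfl

theorem sn_add (u v : JacobiPoint k) :
    (u + v).sn = (u.sn * v.cn * v.dn + v.sn * u.cn * u.dn) / denom u v := rfl

theorem dn_add (u v : JacobiPoint k) :
    (u + v).dn = (u.dn * v.dn - k * u.sn * v.sn * u.cn * v.cn) / denom u v := rfl

theorem denom_comm (u v : JacobiPoint k) : denom u v = denom v u := by
  unfold denom; ring

theorem dn_eq_of_sn_sq {u v : JacobiPoint k} (h : u.sn ^ 2 = v.sn ^ 2) : u.dn = v.dn := by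
  have := u.dn_sq
  rw [h, ← v.dn_sq] at this
  exact (sq_eq_sq₀ u.dn_pos.le v.dn_pos.le).1 this

theorem ext_cn_sn {u v : JacobiPoint k} (hc : u.cn = v.cn) (hs : u.sn = v.sn) : u = v :=
  JacobiPoint.ext hc hs (dn_eq_of_sn_sq (by rw [hs]))

theorem denom_add_mul (u v w : JacobiPoint k) :
    denom (u + v) w * denom u v ^ 2 =
      (1 - k * v.sn ^ 2 * u.sn ^ 2) ^ 2 -
        k * w.sn ^ 2 * (v.sn * (u.cn * u.dn) + u.sn * (v.cn * v.dn)) ^ 2 := by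
  have hs := (eq_div_iff (denom_ne u v)).1 (sn_add u v)
  have e : denom (u + v) w * denom u v ^ 2 =
      denom u v ^ 2 - k * w.sn ^ 2 * ((u + v).sn * denom u v) ^ 2 := by
    unfold denom; ring
  rw [e, hs]
  unfold denom
  ring

/-- On the right, `cn` and `dn` occur only in the product `cn · dn` of one argument, so
associativity for `sn` becomes an identity in `sn` and these products. -/
theorem sn_add_add_mul (u v w : JacobiPoint k) :
    (u + v + w).sn * (denom (u + v) w * denom u v ^ 2) =
      (u.sn * (v.cn * v.dn) + v.sn * (u.cn * u.dn)) * (w.cn * w.dn) *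
          (1 - k * u.sn ^ 2 * v.sn ^ 2) +
        w.sn * ((u.cn * u.dn) * (v.cn * v.dn) * (1 + k * u.sn ^ 2 * v.sn ^ 2) -
          u.sn * v.sn * ((1 - k * u.sn ^ 2) * (1 - k * v.sn ^ 2) +
            k * (1 - u.sn ^ 2) * (1 - v.sn ^ 2))) := by
  have hs := (eq_div_iff (denom_ne u v)).1 (sn_add u v)
  have hc := (eq_div_iff (denom_ne u v)).1 (cn_add u v)
  have hd := (eq_div_iff (denom_ne u v)).1 (dn_add u v)
  have e : (u + v + w).sn * (denom (u + v) w * denom u v ^ 2) =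
      ((u + v).sn * denom u v) * (w.cn * w.dn) * denom u v +
        w.sn * ((u + v).cn * denom u v) * ((u + v).dn * denom u v) := by
    rw [← mul_assoc, (eq_div_iff (denom_ne (u + v) w)).1 (sn_add (u + v) w)]; ring
  rw [e, hs, hc, hd]
  unfold denom
  linear_combination w.sn * (-(u.sn * v.sn) * (u.dn ^ 2 * v.dn_sq
    + (1 - k * v.sn ^ 2) * u.dn_sq + k * u.cn ^ 2 * v.cn_sq + k * (1 - v.sn ^ 2) * u.cn_sq))

theorem cn_add_add_mul (u v w : JacobiPoint k) :
    (u + v + w).cn * (denom (u + v) w * denom u v ^ 2) =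
      (u.cn * v.cn - u.sn * v.sn * u.dn * v.dn) * w.cn * (1 - k * u.sn ^ 2 * v.sn ^ 2) -
        w.sn * w.dn * (u.sn * v.cn * u.dn * (1 - 2 * k * v.sn ^ 2 + k * u.sn ^ 2 * v.sn ^ 2) +
          v.sn * u.cn * v.dn * (1 - 2 * k * u.sn ^ 2 + k * u.sn ^ 2 * v.sn ^ 2)) := by
  have hs := (eq_div_iff (denom_ne u v)).1 (sn_add u v)
  have hc := (eq_div_iff (denom_ne u v)).1 (cn_add u v)
  have hd := (eq_div_iff (denom_ne u v)).1 (dn_add u v)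
  have e : (u + v + w).cn * (denom (u + v) w * denom u v ^ 2) =
      ((u + v).cn * denom u v) * w.cn * denom u v -
        w.sn * w.dn * (((u + v).sn * denom u v) * ((u + v).dn * denom u v)) := by
    rw [← mul_assoc, (eq_div_iff (denom_ne (u + v) w)).1 (cn_add (u + v) w)]; ring
  rw [e, hs, hc, hd]
  unfold denom
  linear_combination -(w.sn * w.dn) * (u.sn * v.cn * u.dn * v.dn_sq
    + v.sn * u.cn * v.dn * u.dn_sq - k * u.sn * v.sn ^ 2 * v.cn * u.dn * u.cn_sq
    - k * v.sn * u.sn ^ 2 * u.cn * v.dn * v.cn_sq)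

protected theorem add_comm (u v : JacobiPoint k) : u + v = v + u := by
  refine ext_cn_sn ?_ ?_
  · rw [cn_add, cn_add, denom_comm]; congr 1; ring
  · rw [sn_add, sn_add, denom_comm]; congr 1; ring

theorem sn_assoc_aux (k s1 s2 s3 e1 e2 e3 : ℝ)
    (h1 : e1 ^ 2 = (1 - s1 ^ 2) * (1 - k * s1 ^ 2))
    (h2 : e2 ^ 2 = (1 - s2 ^ 2) * (1 - k * s2 ^ 2))
    (h3 : e3 ^ 2 = (1 - s3 ^ 2) * (1 - k * s3 ^ 2)) :
    ((s1 * e2 + s2 * e1) * e3 * (1 - k * s1 ^ 2 * s2 ^ 2) +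
        s3 * (e1 * e2 * (1 + k * s1 ^ 2 * s2 ^ 2) - s1 * s2 *
          ((1 - k * s1 ^ 2) * (1 - k * s2 ^ 2) + k * (1 - s1 ^ 2) * (1 - s2 ^ 2)))) *
      ((1 - k * s2 ^ 2 * s3 ^ 2) ^ 2 - k * s1 ^ 2 * (s2 * e3 + s3 * e2) ^ 2) =
    ((s3 * e2 + s2 * e3) * e1 * (1 - k * s3 ^ 2 * s2 ^ 2) +
        s1 * (e3 * e2 * (1 + k * s3 ^ 2 * s2 ^ 2) - s3 * s2 *
          ((1 - k * s3 ^ 2) * (1 - k * s2 ^ 2) + k * (1 - s3 ^ 2) * (1 - s2 ^ 2)))) *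
      ((1 - k * s2 ^ 2 * s1 ^ 2) ^ 2 - k * s3 ^ 2 * (s2 * e1 + s1 * e2) ^ 2) := by
  grind

theorem cn_assoc_aux (k s1 s2 s3 c1 c2 c3 d1 d2 d3 : ℝ)
    (h1 : c1 ^ 2 = 1 - s1 ^ 2) (h2 : c2 ^ 2 = 1 - s2 ^ 2) (h3 : c3 ^ 2 = 1 - s3 ^ 2)
    (g1 : d1 ^ 2 = 1 - k * s1 ^ 2) (g2 : d2 ^ 2 = 1 - k * s2 ^ 2)
    (g3 : d3 ^ 2 = 1 - k * s3 ^ 2) :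
    ((c1 * c2 - s1 * s2 * d1 * d2) * c3 * (1 - k * s1 ^ 2 * s2 ^ 2) -
        s3 * d3 * (s1 * c2 * d1 * (1 - 2 * k * s2 ^ 2 + k * s1 ^ 2 * s2 ^ 2) +
          s2 * c1 * d2 * (1 - 2 * k * s1 ^ 2 + k * s1 ^ 2 * s2 ^ 2))) *
      ((1 - k * s2 ^ 2 * s3 ^ 2) ^ 2 - k * s1 ^ 2 *
        (s2 ^ 2 * ((1 - s3 ^ 2) * (1 - k * s3 ^ 2)) + s3 ^ 2 * ((1 - s2 ^ 2) * (1 - k * s2 ^ 2)) +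
          2 * s2 * s3 * c2 * d2 * c3 * d3)) =
    ((c3 * c2 - s3 * s2 * d3 * d2) * c1 * (1 - k * s3 ^ 2 * s2 ^ 2) -
        s1 * d1 * (s3 * c2 * d3 * (1 - 2 * k * s2 ^ 2 + k * s3 ^ 2 * s2 ^ 2) +
          s2 * c3 * d2 * (1 - 2 * k * s3 ^ 2 + k * s3 ^ 2 * s2 ^ 2))) *
      ((1 - k * s2 ^ 2 * s1 ^ 2) ^ 2 - k * s3 ^ 2 *
        (s2 ^ 2 * ((1 - s1 ^ 2) * (1 - k * s1 ^ 2)) + s1 ^ 2 * ((1 - s2 ^ 2) * (1 - k * s2 ^ 2)) +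
          2 * s2 * s1 * c2 * d2 * c1 * d1)) := by
  -- The second block is the first with indices 1 and 3 exchanged. The coefficients reduce the
  -- squares created when the mixed term `c2 d2 c3 d3` multiplies the first factor.
  linear_combination
    (-2 * k * s1 ^ 2 * s2 * s3) *
      ((c1 * c3 ^ 2 * d2 * d3 * (1 - k * s1 ^ 2 * s2 ^ 2) -
          s1 * s3 * c3 * d1 * d2 * d3 ^ 2 * (1 - 2 * k * s2 ^ 2 + k * s1 ^ 2 * s2 ^ 2)) * h2 +
        (c1 * (1 - s2 ^ 2) * d2 * d3 - s1 * s2 * c2 * d1 * d2 ^ 2 * d3) *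
          (1 - k * s1 ^ 2 * s2 ^ 2) * h3 +
        (-s1 * s2 * c2 * (1 - s3 ^ 2) * d1 * d3 * (1 - k * s1 ^ 2 * s2 ^ 2) -
          s2 * s3 * c1 * c2 * c3 * d3 ^ 2 * (1 - 2 * k * s1 ^ 2 + k * s1 ^ 2 * s2 ^ 2)) * g2 +
        (-s1 * s3 * (1 - s2 ^ 2) * c3 * d1 * d2 * (1 - 2 * k * s2 ^ 2 + k * s1 ^ 2 * s2 ^ 2) -
          s2 * s3 * c1 * c2 * c3 * (1 - k * s2 ^ 2) *
            (1 - 2 * k * s1 ^ 2 + k * s1 ^ 2 * s2 ^ 2)) * g3) -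
    (-2 * k * s3 ^ 2 * s2 * s1) *
      ((c3 * c1 ^ 2 * d2 * d1 * (1 - k * s3 ^ 2 * s2 ^ 2) -
          s3 * s1 * c1 * d3 * d2 * d1 ^ 2 * (1 - 2 * k * s2 ^ 2 + k * s3 ^ 2 * s2 ^ 2)) * h2 +
        (c3 * (1 - s2 ^ 2) * d2 * d1 - s3 * s2 * c2 * d3 * d2 ^ 2 * d1) *
          (1 - k * s3 ^ 2 * s2 ^ 2) * h1 +
        (-s3 * s2 * c2 * (1 - s1 ^ 2) * d3 * d1 * (1 - k * s3 ^ 2 * s2 ^ 2) -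
          s2 * s1 * c3 * c2 * c1 * d1 ^ 2 * (1 - 2 * k * s3 ^ 2 + k * s3 ^ 2 * s2 ^ 2)) * g2 +
        (-s3 * s1 * (1 - s2 ^ 2) * c1 * d3 * d2 * (1 - 2 * k * s2 ^ 2 + k * s3 ^ 2 * s2 ^ 2) -
          s2 * s1 * c3 * c2 * c1 * (1 - k * s2 ^ 2) *
            (1 - 2 * k * s3 ^ 2 + k * s3 ^ 2 * s2 ^ 2)) * g1)

theorem cn_dn_sq (u : JacobiPoint k) :
    (u.cn * u.dn) ^ 2 = (1 - u.sn ^ 2) * (1 - k * u.sn ^ 2) := by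
  rw [mul_pow, u.cn_sq, u.dn_sq]

/-- By commutativity the claim is the invariance of `u + v + w` under exchanging `u` and `w`. -/
protected theorem add_assoc (u v w : JacobiPoint k) : u + v + w = u + (v + w) := by
  rw [JacobiPoint.add_comm u (v + w), JacobiPoint.add_comm v w]
  have h1 : denom (u + v) w * denom u v ^ 2 ≠ 0 :=
    mul_ne_zero (denom_ne _ _) (pow_ne_zero 2 (denom_ne _ _))
  have h2 : denom (w + v) u * denom w v ^ 2 ≠ 0 :=
    mul_ne_zero (denom_ne _ _) (pow_ne_zero 2 (denom_ne _ _))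
  refine ext_cn_sn ?_ ?_ <;> refine mul_right_cancel₀ (mul_ne_zero h1 h2) ?_
  · rw [← mul_assoc (u + v + w).cn, cn_add_add_mul u v w,
      mul_comm (denom (u + v) w * denom u v ^ 2), ← mul_assoc (w + v + u).cn,
      cn_add_add_mul w v u,
      denom_add_mul, denom_add_mul]
    have := cn_assoc_aux k u.sn v.sn w.sn u.cn v.cn w.cn u.dn v.dn w.dn u.cn_sq v.cn_sq w.cn_sq
      u.dn_sq v.dn_sq w.dn_sq
    rw [← cn_dn_sq, ← cn_dn_sq, ← cn_dn_sq] at this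
    linear_combination this
  · rw [← mul_assoc (u + v + w).sn, sn_add_add_mul u v w,
      mul_comm (denom (u + v) w * denom u v ^ 2), ← mul_assoc (w + v + u).sn,
      sn_add_add_mul w v u,
      denom_add_mul, denom_add_mul]
    exact sn_assoc_aux k u.sn v.sn w.sn _ _ _ u.cn_dn_sq v.cn_dn_sq w.cn_dn_sq

noncomputable instance : AddCommGroup (JacobiPoint k) where
  add_assoc := JacobiPoint.add_assoc
  add_comm := JacobiPoint.add_comm
  zero_add u := ext_cn_sn (by simp [cn_add, denom]) (by simp [sn_add, denom])
  add_zero u := ext_cn_sn (by simp [cn_add, denom]) (by simp [sn_add, denom])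
  neg_add_cancel u := by
    have h := denom_ne u u
    unfold denom at h
    refine ext_cn_sn ?_ ?_
    · rw [cn_add, denom, cn_neg, sn_neg, dn_neg, cn_zero, div_eq_one_iff_eq (by simpa using h)]
      linear_combination u.cn_sq + u.sn ^ 2 * u.dn_sq
    · rw [sn_add, cn_neg, sn_neg, dn_neg, sn_zero]
      simp
  nsmul := nsmulRec
  zsmul := zsmulRec

/-! ### Oriented contact of circles with tangent lines. -/

theorem cn_mul_cn (u v : JacobiPoint k) :
    u.cn * v.cn = (u + v).cn + u.sn * v.sn * (u + v).dn := by
  rw [cn_add, dn_add, ← mul_div_assoc, ← add_div, eq_div_iff (denom_ne u v)]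
  unfold denom
  ring

theorem dn_mul_dn (u v : JacobiPoint k) :
    u.dn * v.dn = (u + v).dn + k * u.sn * v.sn * (u + v).cn := by
  rw [cn_add, dn_add, ← mul_div_assoc, ← add_div, eq_div_iff (denom_ne u v)]
  unfold denom
  ring

/-- The radius-zero case of contact: for `w.cn ≠ 0`, it puts the point `(w.dn * z.cn, (1 - k) *
z.sn) / (z.dn * w.cn)` on the tangent `z + w`, and by evenness in `w` also on `z - w`. -/
theorem tangent_relation_even (z w : JacobiPoint k) :
    w.dn * z.cn * (z + w).cn + (1 - k) * z.sn * (z + w).sn = z.dn * w.cn * (z + w).dn := by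
  rw [cn_add, dn_add, sn_add, ← mul_div_assoc, ← mul_div_assoc, ← mul_div_assoc, ← add_div]
  congr 1
  have h1 := z.cn_sq
  have h2 := w.cn_sq
  have h3 := z.dn_sq
  have h4 := w.dn_sq
  grind

theorem tangent_relation_odd (z w : JacobiPoint k) :
    k * w.cn * z.cn * (z + w).cn + (1 - k) = z.dn * w.dn * (z + w).dn := by
  rw [cn_add, dn_add, ← mul_div_assoc, ← mul_div_assoc, div_add' _ _ _ (denom_ne z w)]
  congr 1
  unfold denom
  have h1 := z.cn_sq
  have h2 := w.cn_sq
  have h3 := z.dn_sq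
  have h4 := w.dn_sq
  grind

/-- A circle in oriented contact with the tangent line of argument `z + u + v`; its centre and
radius, up to a common factor, depend on `u` and `v` only through products of even or of odd
functions. -/
theorem contact_relation (z u v : JacobiPoint k) :
    u.dn * v.dn * z.cn * (z + (u + v)).cn + (1 - k) * z.sn * (z + (u + v)).sn +
      (1 - k) * u.sn * v.sn = z.dn * (u.cn * v.cn) * (z + (u + v)).dn := by
  -- For fixed `u + v` both products are affine in `u.sn * v.sn`. The constant term is the even
  -- relation and the coefficient is the odd one.
  rw [cn_mul_cn u v, dn_mul_dn u v]
  linear_combination tangent_relation_even z (u + v) + u.sn * v.sn * tangent_relation_odd z (u + v)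

/-! ### Halving and doubling. -/

theorem neg_one_lt_cn {u : JacobiPoint k} (h : u.cn ≠ -1) : -1 < u.cn := by
  refine lt_of_le_of_ne ?_ h.symm
  nlinarith [u.cn_sq, sq_nonneg u.sn]

/-- `dn² - cn² = (1 - k) · sn²` vanishes only when `sn = 0`, and then `cn = 1`. -/
theorem cn_add_dn_pos {u : JacobiPoint k} (h : u.cn ≠ -1) : 0 < u.cn + u.dn := by
  by_contra! hn
  have h1 := neg_one_lt_cn h
  have h2 := u.dn_pos
  have h3 : u.dn ^ 2 ≤ u.cn ^ 2 := by nlinarith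
  rw [u.dn_sq, u.cn_sq] at h3
  have h4 : (1 - (k : ℝ)) * u.sn ^ 2 ≤ 0 := by linarith
  have h5 : u.sn ^ 2 = 0 :=
    le_antisymm (nonpos_of_mul_nonpos_right h4 (sub_pos.2 k.2.2)) (sq_nonneg _)
  have h6 := u.cn_sq
  rw [h5] at h6
  nlinarith

theorem exists_half {u : JacobiPoint k} (h : u.cn ≠ -1) :
    ∃ v : JacobiPoint k, v + v = u ∧ 0 < v.cn := by
  have hc : 0 < 1 + u.cn := by linarith [neg_one_lt_cn h]
  have hd : 0 < 1 + u.dn := by linarith [u.dn_pos]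
  have hg := cn_add_dn_pos h
  obtain ⟨a, ha, ha2⟩ : ∃ a, 0 < a ∧ a ^ 2 = 1 + u.cn :=
    ⟨√(1 + u.cn), Real.sqrt_pos.2 hc, Real.sq_sqrt hc.le⟩
  obtain ⟨b, hb, hb2⟩ : ∃ b, 0 < b ∧ b ^ 2 = 1 + u.dn :=
    ⟨√(1 + u.dn), Real.sqrt_pos.2 hd, Real.sq_sqrt hd.le⟩
  obtain ⟨g, hg0, hg2⟩ : ∃ g, 0 < g ∧ g ^ 2 = u.cn + u.dn :=
    ⟨√(u.cn + u.dn), Real.sqrt_pos.2 hg, Real.sq_sqrt hg.le⟩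
  have h1 := u.cn_sq
  have h2 := u.dn_sq
  have hgab : g ^ 2 = a ^ 2 + b ^ 2 - 2 := by linarith
  have hs : u.sn ^ 2 = a ^ 2 * (2 - a ^ 2) := by rw [ha2]; linarith
  have hks : k * u.sn ^ 2 = b ^ 2 * (2 - b ^ 2) := by rw [hb2]; linarith
  -- Half-argument formulas `cn² = (c + d)/(1 + d)`, `sn² = (1 - c)/(1 + d)`, `dn² = (c + d)/(1 +
  -- c)`. Writing `sn` with numerator `u.sn` gives it the right sign.
  let v : JacobiPoint k :=
    { cn := g / b
      sn := u.sn / (a * b)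
      dn := g / a
      cn_sq := by
        rw [div_pow, div_pow, mul_pow, hs, hgab]
        field_simp
        ring
      dn_sq := by
        rw [div_pow, div_pow, ← mul_div_assoc, hks, hgab]
        field_simp
        ring
      dn_pos := div_pos hg0 ha }
  have hD : denom v v = 2 * g ^ 2 / (a ^ 2 * b ^ 2) := by
    have e : denom v v = 1 - (k * u.sn ^ 2) * u.sn ^ 2 / (a * b) ^ 4 := by
      change 1 - k * (u.sn / (a * b)) ^ 2 * (u.sn / (a * b)) ^ 2 = _
      field_simp
    rw [e, hks, hs, hgab]
    field_simp
    ring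
  refine ⟨v, ext_cn_sn ?_ ?_, div_pos hg0 hb⟩
  · rw [cn_add, hD]
    change (g / b * (g / b) - u.sn / (a * b) * (u.sn / (a * b)) * (g / a) * (g / a)) / _ = _
    rw [show u.cn = a ^ 2 - 1 by linarith]
    field_simp
    rw [hs]
    ring
  · rw [sn_add, hD]
    change (u.sn / (a * b) * (g / b) * (g / a) + u.sn / (a * b) * (g / b) * (g / a)) / _ = _
    field_simp
    ring

/-- `cn` of a double is a function of `sn²` alone, and `cn` fixes a Jacobi point up to sign. -/
theorem add_self_eq_or_eq_neg {u v : JacobiPoint k} (h : u.sn ^ 2 = v.sn ^ 2) :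
    u + u = v + v ∨ u + u = -(v + v) := by
  have e : ∀ w : JacobiPoint k, (w + w).cn =
      (1 - w.sn ^ 2 - w.sn ^ 2 * (1 - k * w.sn ^ 2)) / (1 - k * w.sn ^ 2 * w.sn ^ 2) := by
    intro w
    rw [← w.dn_sq, ← w.cn_sq, cn_add, denom]
    congr 1
    ring
  have hc : (u + u).cn = (v + v).cn := by rw [e u, e v, h]
  have hs : (u + u).sn ^ 2 = (v + v).sn ^ 2 := by
    linarith [(u + u).cn_sq, (v + v).cn_sq, congrArg (· ^ 2) hc]
  rcases sq_eq_sq_iff_eq_or_eq_neg.1 hs with h1 | h1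
  · exact Or.inl (ext_cn_sn hc h1)
  · exact Or.inr (ext_cn_sn hc h1)

theorem sn_ne_zero_of_add_self_ne_zero {u : JacobiPoint k} (h : u + u ≠ 0) : u.sn ≠ 0 := by
  intro hs
  refine h (ext_cn_sn ?_ ?_)
  · rw [cn_add, denom, hs, cn_zero]
    have := u.cn_sq
    rw [hs] at this
    norm_num
    linarith
  · rw [sn_add, hs]; simp

/-! ### Tangent lines that meet on a confocal ellipse. -/

/-- Parallel lines with a common point coincide; `dn > 0` excludes opposite unit normals. -/
theorem eq_of_det_eq_zero {u v : JacobiPoint k} {x y : ℝ}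
    (hu : u.cn * x + u.sn * y = u.dn) (hv : v.cn * x + v.sn * y = v.dn)
    (h : u.cn * v.sn - u.sn * v.cn = 0) : u = v := by
  have hu1 := u.cn_sq
  have hv1 := v.cn_sq
  have hc : v.cn = (u.cn * v.cn + u.sn * v.sn) * u.cn := by
    linear_combination -v.cn * hu1 - u.sn * h
  have hs : v.sn = (u.cn * v.cn + u.sn * v.sn) * u.sn := by
    linear_combination -v.sn * hu1 + u.cn * h
  have hd : v.dn = (u.cn * v.cn + u.sn * v.sn) * u.dn := by
    linear_combination -hv + (u.cn * v.cn + u.sn * v.sn) * hu + x * hc + y * hs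
  have hpos : 0 < u.cn * v.cn + u.sn * v.sn := by
    have := v.dn_pos
    rw [hd] at this
    exact pos_of_mul_pos_left this u.dn_pos.le
  have hsq : (u.cn * v.cn + u.sn * v.sn) ^ 2 = 1 := by
    linear_combination v.cn ^ 2 * hu1 + (1 - u.sn ^ 2) * hv1 - (u.cn * v.sn - u.sn * v.cn) * h
      + u.sn ^ 2 * hv1 + v.sn ^ 2 * hu1
  have hone : u.cn * v.cn + u.sn * v.sn = 1 := by nlinarith
  rw [hone, one_mul] at hc hs
  exact ext_cn_sn hc.symm hs.symm

theorem confocal_unique {b x y r r' : ℝ} (hb : 0 < b) (hr : 0 ≤ r) (hr' : 0 ≤ r')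
    (h : x ^ 2 / (1 + r) + y ^ 2 / (b + r) = 1)
    (h' : x ^ 2 / (1 + r') + y ^ 2 / (b + r') = 1) : r = r' := by
  have e : (r' - r) * (x ^ 2 / ((1 + r) * (1 + r')) + y ^ 2 / ((b + r) * (b + r'))) = 0 := by
    have e1 : x ^ 2 / (1 + r) - x ^ 2 / (1 + r') =
        (r' - r) * (x ^ 2 / ((1 + r) * (1 + r'))) := by field_simp; ring
    have e2 : y ^ 2 / (b + r) - y ^ 2 / (b + r') =
        (r' - r) * (y ^ 2 / ((b + r) * (b + r'))) := by field_simp; ring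
    rw [mul_add, ← e1, ← e2]; linarith
  rcases mul_eq_zero.1 e with h0 | h0
  · linarith
  · exfalso
    have h1 : 0 ≤ x ^ 2 / ((1 + r) * (1 + r')) := by positivity
    have h2 : 0 ≤ y ^ 2 / ((b + r) * (b + r')) := by positivity
    have h3 : x ^ 2 / ((1 + r) * (1 + r')) = 0 := by linarith
    have h4 : y ^ 2 / ((b + r) * (b + r')) = 0 := by linarith
    have hx : x ^ 2 = 0 := (div_eq_zero_iff.1 h3).resolve_right (by positivity)
    have hy : y ^ 2 = 0 := (div_eq_zero_iff.1 h4).resolve_right (by positivity)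
    rw [hx, hy] at h
    simp at h

/-- Two tangent lines of an ellipse that meet on a fixed confocal ellipse have arguments whose
difference is determined up to sign. -/
theorem exists_half_sub_of_mem_confocal {u v : JacobiPoint k} (hne : u ≠ v) {x y r : ℝ}
    (hu : u.cn * x + u.sn * y = u.dn) (hv : v.cn * x + v.sn * y = v.dn) (hr : 0 ≤ r)
    (h : x ^ 2 / (1 + r) + y ^ 2 / (1 - k + r) = 1) :
    ∃ w : JacobiPoint k, v = u + (w + w) ∧ w.sn ^ 2 = r / (1 - k + r) := by
  have hb : 0 < 1 - (k : ℝ) := sub_pos.2 k.2.2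
  have hdet : u.cn * v.sn - u.sn * v.cn ≠ 0 := fun h0 => hne (eq_of_det_eq_zero hu hv h0)
  -- Otherwise `v - u` is the point `(-1, 0, 1)` of order two, and the two normals are opposite.
  have hcn : (v - u).cn ≠ -1 := by
    intro hc
    have hs : (v - u).sn = 0 := by
      have := (v - u).cn_sq
      rw [hc] at this
      exact pow_eq_zero_iff two_ne_zero |>.1 (by linarith)
    have hd : (v - u).dn = 1 := dn_eq_of_sn_sq (v := 0) (by rw [hs, sn_zero])
    have e : v = u + (v - u) := by abel
    refine hdet ?_
    rw [e, sn_add, cn_add, hs, hc, hd, denom, hs]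
    ring
  obtain ⟨w, hw, hwc⟩ := exists_half hcn
  refine ⟨w, by rw [hw]; abel, ?_⟩
  set z := u + w with hz
  have hzd := z.dn_pos
  have hvz : v = z + (w + 0) := by rw [hz, add_zero, add_assoc, hw]; abel
  have huz : u = z + (-w + 0) := by rw [hz]; abel
  -- With last argument `0` the circle degenerates to the intersection of the tangents `z + w = v`
  -- and `z - w = u`.
  have c1 := contact_relation z w 0
  have c2 := contact_relation z (-w) 0
  rw [← hvz] at c1
  rw [← huz] at c2
  simp only [cn_zero, sn_zero, dn_zero, mul_one, mul_zero, add_zero, dn_neg, cn_neg] at c1 c2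
  have hx : x * (z.dn * w.cn) = w.dn * z.cn := by
    apply mul_left_cancel₀ hdet
    linear_combination z.dn * w.cn * (v.sn * hu - u.sn * hv) - (v.sn * c2 - u.sn * c1)
  have hy : y * (z.dn * w.cn) = (1 - k) * z.sn := by
    apply mul_left_cancel₀ hdet
    linear_combination z.dn * w.cn * (u.cn * hv - v.cn * hu) - (u.cn * c1 - v.cn * c2)
  have hx' : x = w.dn * z.cn / (z.dn * w.cn) := by rw [eq_div_iff (by positivity), hx]
  have hy' : y = (1 - k) * z.sn / (z.dn * w.cn) := by rw [eq_div_iff (by positivity), hy]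
  have hwd := w.dn_pos
  -- `(1 - k) * w.sn ^ 2 / w.cn ^ 2` is the confocal parameter of the intersection point, hence
  -- equals `r` by `confocal_unique`.
  have e1 : 1 + (1 - k) * w.sn ^ 2 / w.cn ^ 2 = w.dn ^ 2 / w.cn ^ 2 := by
    rw [w.dn_sq, eq_div_iff (by positivity), add_mul, div_mul_cancel₀ _ (by positivity), w.cn_sq]
    ring
  have e2 : 1 - k + (1 - k) * w.sn ^ 2 / w.cn ^ 2 = (1 - k) / w.cn ^ 2 := by
    rw [eq_div_iff (by positivity), add_mul, div_mul_cancel₀ _ (by positivity), w.cn_sq]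
    ring
  have key : x ^ 2 / (1 + (1 - k) * w.sn ^ 2 / w.cn ^ 2) +
      y ^ 2 / (1 - k + (1 - k) * w.sn ^ 2 / w.cn ^ 2) = 1 := by
    have e3 : z.cn ^ 2 + (1 - k) * z.sn ^ 2 = z.dn ^ 2 := by rw [z.cn_sq, z.dn_sq]; ring
    rw [e1, e2, hx', hy']
    have := hb.ne'
    field_simp
    linarith
  have hrr := confocal_unique hb hr (by positivity) h key
  have hw2 := w.cn_sq
  rw [hrr, e2, div_div_div_cancel_right₀ (by positivity)]
  field_simp

end JacobiPoint
-- Lines in normal form, half-spheres and tangency.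
/-- The line `l` has unit normal vector `n` and positive distance `h` from the origin. -/
structure IsNormalForm (l : AffineSubspace ℝ Plane) (n : Plane) (h : ℝ) : Prop where
  unit : n 0 ^ 2 + n 1 ^ 2 = 1
  pos : 0 < h
  mem_iff : ∀ q : Plane, q ∈ l ↔ n 0 * q 0 + n 1 * q 1 = h

namespace IsNormalForm

variable {l : AffineSubspace ℝ Plane} {n : Plane} {h : ℝ}

theorem isOrientedCoord (hl : IsNormalForm l n h) :
    IsOrientedCoord l !₂[-n 0, -n 1, h] := by
  refine ⟨fun q => ?_, hl.pos⟩
  rw [hl.mem_iff]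
  simp only [Matrix.cons_val]
  constructor <;> intro hq <;> linarith

theorem norm_homogeneous_pos (q : Plane) : 0 < ‖(!₂[q 0, q 1, 1] : Space)‖ := by
  rw [norm_pos_iff]
  intro h0
  have := congrArg (fun v : Space => v 2) h0
  simp at this

theorem posRep_mem_sphere (q : Plane) : posRep q ∈ Metric.sphere (0 : Space) 1 := by
  rw [mem_sphere_zero_iff_norm, posRep, norm_smul, norm_inv, norm_norm,
    inv_mul_cancel₀ (norm_homogeneous_pos q).ne']

theorem negRep_mem_sphere (q : Plane) : negRep q ∈ Metric.sphere (0 : Space) 1 := by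
  rw [mem_sphere_zero_iff_norm, negRep, norm_neg]
  exact mem_sphere_zero_iff_norm.1 (posRep_mem_sphere q)

theorem eval_posRep (q : Plane) :
    (!₂[-n 0, -n 1, h] : Space) 0 * posRep q 0 + (!₂[-n 0, -n 1, h] : Space) 1 * posRep q 1 +
      (!₂[-n 0, -n 1, h] : Space) 2 * posRep q 2 =
    ‖(!₂[q 0, q 1, 1] : Space)‖⁻¹ * (h - (n 0 * q 0 + n 1 * q 1)) := by
  simp only [posRep, PiLp.smul_apply, Matrix.cons_val, smul_eq_mul]
  ring

theorem eval_negRep (q : Plane) :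
    (!₂[-n 0, -n 1, h] : Space) 0 * negRep q 0 + (!₂[-n 0, -n 1, h] : Space) 1 * negRep q 1 +
      (!₂[-n 0, -n 1, h] : Space) 2 * negRep q 2 =
    ‖(!₂[q 0, q 1, 1] : Space)‖⁻¹ * ((n 0 * q 0 + n 1 * q 1) - h) := by
  simp only [negRep, posRep, PiLp.neg_apply, PiLp.smul_apply, Matrix.cons_val,
    smul_eq_mul]
  ring

theorem posRep_mem_posHalf (hl : IsNormalForm l n h) {q : Plane}
    (hq : n 0 * q 0 + n 1 * q 1 < h) : posRep q ∈ posHalf l :=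
  ⟨posRep_mem_sphere q, _, hl.isOrientedCoord, by
    rw [eval_posRep]
    exact mul_pos (inv_pos.2 (norm_homogeneous_pos q)) (sub_pos.2 hq)⟩

theorem posRep_mem_negHalf (hl : IsNormalForm l n h) {q : Plane}
    (hq : h < n 0 * q 0 + n 1 * q 1) : posRep q ∈ negHalf l :=
  ⟨posRep_mem_sphere q, _, hl.isOrientedCoord, by
    rw [eval_posRep]
    exact mul_neg_of_pos_of_neg (inv_pos.2 (norm_homogeneous_pos q)) (sub_neg.2 hq)⟩

theorem negRep_mem_posHalf (hl : IsNormalForm l n h) {q : Plane}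
    (hq : h < n 0 * q 0 + n 1 * q 1) : negRep q ∈ posHalf l :=
  ⟨negRep_mem_sphere q, _, hl.isOrientedCoord, by
    rw [eval_negRep]
    exact mul_pos (inv_pos.2 (norm_homogeneous_pos q)) (sub_pos.2 hq)⟩

theorem negRep_mem_negHalf (hl : IsNormalForm l n h) {q : Plane}
    (hq : n 0 * q 0 + n 1 * q 1 < h) : negRep q ∈ negHalf l :=
  ⟨negRep_mem_sphere q, _, hl.isOrientedCoord, by
    rw [eval_negRep]
    exact mul_neg_of_pos_of_neg (inv_pos.2 (norm_homogeneous_pos q)) (sub_neg.2 hq)⟩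

theorem abs_sub_le_dist (hl : IsNormalForm l n h) (q c : Plane) :
    |(n 0 * q 0 + n 1 * q 1) - (n 0 * c 0 + n 1 * c 1)| ≤ dist q c := by
  rw [EuclideanSpace.dist_eq, Fin.sum_univ_two, Real.dist_eq, Real.dist_eq, sq_abs, sq_abs]
  refine Real.abs_le_sqrt ?_
  nlinarith [hl.unit, sq_nonneg (n 0 * (q 1 - c 1) - n 1 * (q 0 - c 0))]

theorem isTangent (hl : IsNormalForm l n h) {c : Plane} {R : ℝ}
    (hR : |h - (n 0 * c 0 + n 1 * c 1)| = R) :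
    (⟨c, R⟩ : EuclideanGeometry.Sphere Plane).IsTangent l := by
  set ρ := h - (n 0 * c 0 + n 1 * c 1) with hρ
  have hn := hl.unit
  refine ⟨c + ρ • n, ?_, ?_, ?_⟩
  · rw [EuclideanGeometry.mem_sphere, dist_self_add_left, norm_smul, EuclideanSpace.norm_eq,
      Fin.sum_univ_two, Real.norm_eq_abs, Real.norm_eq_abs, Real.norm_eq_abs, sq_abs, sq_abs, hn,
      Real.sqrt_one, mul_one, hR]
  · rw [hl.mem_iff]
    simp only [PiLp.add_apply, PiLp.smul_apply, smul_eq_mul]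
    linear_combination ρ * hn + hρ
  · intro q hq
    rw [hl.mem_iff] at hq
    rw [EuclideanGeometry.Sphere.mem_orthRadius_iff_inner_left]
    simp only [vsub_eq_sub, add_sub_cancel_left, PiLp.inner_apply, Fin.sum_univ_two,
      PiLp.sub_apply, PiLp.add_apply, PiLp.smul_apply, smul_eq_mul, RCLike.inner_apply,
      conj_trivial]
    linear_combination ρ * hq - ρ ^ 2 * hn - ρ * hρ

end IsNormalForm

/-- Four lines whose signed distances from a point are alternately `ρ ≠ 0` and `-ρ`. -/
theorem exists_isIncircle {m : ℕ} {L : ZMod m → AffineSubspace ℝ Plane} {n : ZMod m → Plane}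
    {h : ZMod m → ℝ} (hL : ∀ i, IsNormalForm (L i) (n i) (h i)) {a b c d : ZMod m} {o : Plane}
    {ρ : ℝ} (hρ : ρ ≠ 0)
    (ha : h a - (n a 0 * o 0 + n a 1 * o 1) = ρ) (hb : h b - (n b 0 * o 0 + n b 1 * o 1) = -ρ)
    (hc : h c - (n c 0 * o 0 + n c 1 * o 1) = -ρ)
    (hd : h d - (n d 0 * o 0 + n d 1 * o 1) = ρ) :
    ∃ S : EuclideanGeometry.Sphere Plane, IsIncircle L a b c d S := by
  refine ⟨⟨o, |ρ|⟩, abs_pos.2 hρ, ?_, (hL a).isTangent (by rw [ha]),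
    (hL b).isTangent (by rw [hb, abs_neg]), (hL c).isTangent (by rw [hc, abs_neg]),
    (hL d).isTangent (by rw [hd])⟩
  rcases hρ.lt_or_gt with h0 | h0
  · right
    intro q hq
    rw [Metric.mem_ball, abs_of_neg h0] at hq
    have key := fun i => abs_le.1 ((hL i).abs_sub_le_dist q o)
    refine ⟨⟨(hL a).negRep_mem_posHalf ?_, (hL b).negRep_mem_negHalf ?_⟩,
      ⟨(hL d).negRep_mem_posHalf ?_, (hL c).negRep_mem_negHalf ?_⟩⟩
    · linarith [(key a).1]
    · linarith [(key b).2]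
    · linarith [(key d).1]
    · linarith [(key c).2]
  · left
    intro q hq
    rw [Metric.mem_ball, abs_of_pos h0] at hq
    have key := fun i => abs_le.1 ((hL i).abs_sub_le_dist q o)
    refine ⟨⟨(hL a).posRep_mem_posHalf ?_, (hL b).posRep_mem_negHalf ?_⟩,
      ⟨(hL d).posRep_mem_posHalf ?_, (hL c).posRep_mem_negHalf ?_⟩⟩
    · linarith [(key a).2]
    · linarith [(key b).1]
    · linarith [(key d).2]
    · linarith [(key c).1]

/-! ### Ellipses and their tangents in coordinates adapted to the foci. -/

/-- The coordinate of `q` along the unit vector `e`, in units of `s`. -/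
noncomputable def majorCoord (e : Plane) (s : ℝ) (q : Plane) : ℝ := (e 0 * q 0 + e 1 * q 1) / s

/-- The coordinate of `q` orthogonal to the unit vector `e`, in units of `s`. -/
noncomputable def minorCoord (e : Plane) (s : ℝ) (q : Plane) : ℝ := (e 0 * q 1 - e 1 * q 0) / s

theorem exists_unit_eq_norm_smul (f : Plane) :
    ∃ e : Plane, e 0 ^ 2 + e 1 ^ 2 = 1 ∧ f = ‖f‖ • e := by
  by_cases hf : f = 0
  · exact ⟨!₂[1, 0], by simp, by simp [hf]⟩
  · have hn : ‖f‖ ≠ 0 := norm_ne_zero_iff.2 hf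
    refine ⟨‖f‖⁻¹ • f, ?_, by rw [smul_smul, mul_inv_cancel₀ hn, one_smul]⟩
    have h : ‖f‖ ^ 2 = f 0 ^ 2 + f 1 ^ 2 := by
      rw [EuclideanSpace.norm_sq_eq, Fin.sum_univ_two, Real.norm_eq_abs, Real.norm_eq_abs, sq_abs,
        sq_abs]
    simp only [PiLp.smul_apply, smul_eq_mul]
    rw [mul_pow, mul_pow, ← mul_add, ← h, inv_pow, inv_mul_cancel₀ (pow_ne_zero 2 hn)]

/-- On the ellipse the focal distances are `s - c x / s` and `s + c x / s`; both directions go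
through these values. -/
theorem add_eq_two_mul_iff {a b c s x y : ℝ} (ha : 0 ≤ a) (hb : 0 ≤ b) (hc : 0 ≤ c) (hcs : c < s)
    (ha2 : a ^ 2 = (x - c) ^ 2 + y ^ 2) (hb2 : b ^ 2 = (x + c) ^ 2 + y ^ 2) :
    a + b = 2 * s ↔ x ^ 2 / s ^ 2 + y ^ 2 / (s ^ 2 - c ^ 2) = 1 := by
  have hs : 0 < s := hc.trans_lt hcs
  have hd : 0 < s ^ 2 - c ^ 2 := by nlinarith
  have hiff : x ^ 2 / s ^ 2 + y ^ 2 / (s ^ 2 - c ^ 2) = 1 ↔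
      x ^ 2 * (s ^ 2 - c ^ 2) + s ^ 2 * y ^ 2 = s ^ 2 * (s ^ 2 - c ^ 2) := by
    rw [div_add_div _ _ (by positivity) hd.ne', div_eq_one_iff_eq (by positivity)]
  rw [hiff]
  constructor
  · intro h
    have h1 : s * (b - a) = 2 * c * x := by
      have : (a + b) * (b - a) = 4 * c * x := by linear_combination hb2 - ha2
      rw [h] at this
      linarith
    have h2 : s * a = s ^ 2 - c * x := by
      linear_combination s / 2 * h - h1 / 2
    linear_combination (-s ^ 2) * ha2 + (s * a + (s ^ 2 - c * x)) * h2
  · intro h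
    have hx : x ^ 2 ≤ s ^ 2 := by
      have : x ^ 2 * (s ^ 2 - c ^ 2) ≤ s ^ 2 * (s ^ 2 - c ^ 2) := by
        nlinarith [sq_nonneg (s * y)]
      exact le_of_mul_le_mul_right this hd
    have hx' := abs_le_of_sq_le_sq' hx hs.le
    have h1 : 0 ≤ s ^ 2 - c * x := by nlinarith
    have h2 : 0 ≤ s ^ 2 + c * x := by nlinarith
    have h3 : s * a = s ^ 2 - c * x :=
      (sq_eq_sq₀ (by positivity) h1).1 (by linear_combination s ^ 2 * ha2 + h)
    have h4 : s * b = s ^ 2 + c * x :=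
      (sq_eq_sq₀ (by positivity) h2).1 (by linear_combination s ^ 2 * hb2 + h)
    apply mul_left_cancel₀ hs.ne'
    linear_combination h3 + h4

theorem mem_ellipse_iff {e : Plane} (he : e 0 ^ 2 + e 1 ^ 2 = 1) {c s t : ℝ} (hc : 0 ≤ c)
    (hs : 0 < s) (hct : c < t) (q : Plane) :
    q ∈ ellipse (c • e) t ↔ majorCoord e s q ^ 2 / (t ^ 2 / s ^ 2) +
      minorCoord e s q ^ 2 / ((t ^ 2 - c ^ 2) / s ^ 2) = 1 := by
  have h1 : dist q (c • e) ^ 2 =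
      (e 0 * q 0 + e 1 * q 1 - c) ^ 2 + (e 0 * q 1 - e 1 * q 0) ^ 2 := by
    rw [EuclideanSpace.dist_sq_eq, Fin.sum_univ_two, Real.dist_eq, Real.dist_eq, sq_abs, sq_abs]
    simp only [PiLp.smul_apply, smul_eq_mul]
    linear_combination (c ^ 2 - q 0 ^ 2 - q 1 ^ 2) * he
  have h2 : dist q (-(c • e)) ^ 2 =
      (e 0 * q 0 + e 1 * q 1 + c) ^ 2 + (e 0 * q 1 - e 1 * q 0) ^ 2 := by
    rw [EuclideanSpace.dist_sq_eq, Fin.sum_univ_two, Real.dist_eq, Real.dist_eq, sq_abs, sq_abs]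
    simp only [PiLp.neg_apply, PiLp.smul_apply, smul_eq_mul]
    linear_combination (c ^ 2 - q 0 ^ 2 - q 1 ^ 2) * he
  rw [ellipse, Set.mem_ofPred_eq, add_eq_two_mul_iff dist_nonneg dist_nonneg hc hct h1 h2,
    majorCoord, minorCoord, div_pow, div_pow, div_div_div_cancel_right₀ (by positivity),
    div_div_div_cancel_right₀ (by positivity)]

theorem ext_coord {e : Plane} (he : e 0 ^ 2 + e 1 ^ 2 = 1) {s : ℝ} (hs : 0 < s) {q q' : Plane}
    (h1 : majorCoord e s q = majorCoord e s q') (h2 : minorCoord e s q = minorCoord e s q') :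
    q = q' := by
  have h1' := (div_left_inj' hs.ne').1 h1
  have h2' := (div_left_inj' hs.ne').1 h2
  ext i
  fin_cases i
  · change q 0 = q' 0
    linear_combination (q' 0 - q 0) * he + e 0 * h1' - e 1 * h2'
  · change q 1 = q' 1
    linear_combination (q' 1 - q 1) * he + e 1 * h1' + e 0 * h2'

theorem majorCoord_add_smul (e : Plane) (s : ℝ) (q v : Plane) (τ : ℝ) :
    majorCoord e s (q + τ • v) = majorCoord e s q + τ * majorCoord e s v := by
  simp only [majorCoord, PiLp.add_apply, PiLp.smul_apply, smul_eq_mul]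
  ring

theorem minorCoord_add_smul (e : Plane) (s : ℝ) (q v : Plane) (τ : ℝ) :
    minorCoord e s (q + τ • v) = minorCoord e s q + τ * minorCoord e s v := by
  simp only [minorCoord, PiLp.add_apply, PiLp.smul_apply, smul_eq_mul]
  ring

/-- A tangent line of the ellipse `x² + y² / (1 - k) = 1`, in Jacobi's parametrization. -/
theorem exists_jacobiPoint_of_tangent {e : Plane} (he : e 0 ^ 2 + e 1 ^ 2 = 1) {s : ℝ}
    (hs : 0 < s) {k : Set.Ico (0 : ℝ) 1} {X : Set Plane}
    (hX : ∀ q, q ∈ X ↔ majorCoord e s q ^ 2 + minorCoord e s q ^ 2 / (1 - k) = 1)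
    {p p' : Plane} (hp : p ≠ p') (ht : TangentToEllipse X line[ℝ, p, p']) :
    ∃ u : JacobiPoint k, ∀ q, q ∈ line[ℝ, p, p'] ↔
      u.cn * majorCoord e s q + u.sn * minorCoord e s q = u.dn := by
  have hb : 0 < 1 - (k : ℝ) := sub_pos.2 k.2.2
  obtain ⟨o, ⟨hol, hoX⟩, huniq⟩ := ht
  set v : Plane := p' - p with hv
  have hline : ∀ q, q ∈ line[ℝ, p, p'] ↔ ∃ τ : ℝ, q = o + τ • v := by
    intro q
    obtain ⟨σ, hσ⟩ := mem_affineSpan_pair_iff_exists_lineMap_eq.1 hol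
    rw [AffineMap.lineMap_apply_module'] at hσ
    rw [mem_affineSpan_pair_iff_exists_lineMap_eq]
    constructor
    · rintro ⟨r, hr⟩
      rw [AffineMap.lineMap_apply_module'] at hr
      refine ⟨r - σ, ?_⟩
      rw [← hr, ← hσ, hv]
      module
    · rintro ⟨τ, rfl⟩
      refine ⟨τ + σ, ?_⟩
      rw [AffineMap.lineMap_apply_module', ← hσ, hv]
      module
  have hv0 : majorCoord e s v ≠ 0 ∨ minorCoord e s v ≠ 0 := by
    by_contra! h
    apply hp
    have h0 : v = 0 := ext_coord he hs (by rw [h.1]; simp [majorCoord])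
      (by rw [h.2]; simp [minorCoord])
    exact (sub_eq_zero.1 h0).symm
  set v1 := majorCoord e s v with hv1
  set v2 := minorCoord e s v with hv2
  set x := majorCoord e s o with hx
  set y := minorCoord e s o with hy
  have hxy : x ^ 2 + y ^ 2 / (1 - k) = 1 := (hX o).1 hoX
  have hvv : 0 < v1 ^ 2 + v2 ^ 2 := by
    rcases hv0 with h | h <;> positivity
  have hQ : 0 < v1 ^ 2 + v2 ^ 2 / (1 - k) := by
    rcases hv0 with h | h <;> positivity
  have horth : x * v1 + y * v2 / (1 - k) = 0 := by
    set B := x * v1 + y * v2 / (1 - k) with hB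
    set Q := v1 ^ 2 + v2 ^ 2 / (1 - k) with hQdef
    -- This is the second intersection of the line with the ellipse; tangency makes it equal to `o`,
    -- so `B = 0`.
    have h1 : o + (-2 * B / Q) • v = o := by
      refine huniq _ ⟨(hline _).2 ⟨_, rfl⟩, (hX _).2 ?_⟩
      rw [majorCoord_add_smul, minorCoord_add_smul, ← hv1, ← hv2, ← hx, ← hy]
      have e1 : (-2 * B / Q) * Q = -2 * B := div_mul_cancel₀ _ hQ.ne'
      generalize -2 * B / Q = τ at e1
      have e2 : (x + τ * v1) ^ 2 + (y + τ * v2) ^ 2 / (1 - k) =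
          (x ^ 2 + y ^ 2 / (1 - k)) + τ * (2 * B) + τ * (τ * Q) := by
        rw [hB, hQdef]; ring
      rw [e2, e1, hxy]; ring
    have h2 : (-2 * B / Q) • v = 0 := by simpa using h1
    rcases smul_eq_zero.1 h2 with h3 | h3
    · have := (div_eq_zero_iff.1 h3).resolve_right hQ.ne'
      linarith
    · exfalso
      rw [hv, sub_eq_zero] at h3
      exact hp h3.symm
  have hN : 0 < x ^ 2 + (y / (1 - k)) ^ 2 := by
    by_cases hx0 : x = 0
    · have hy0 : y ≠ 0 := by
        rintro h
        rw [hx0, h] at hxy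
        simp at hxy
      positivity
    · positivity
  obtain ⟨N, hNpos, hN2⟩ : ∃ N, 0 < N ∧ N ^ 2 = x ^ 2 + (y / (1 - k)) ^ 2 :=
    ⟨√(x ^ 2 + (y / (1 - k)) ^ 2), Real.sqrt_pos.2 hN, Real.sq_sqrt hN.le⟩
  have hxy' : x ^ 2 + (1 - k) * (y / (1 - k)) ^ 2 = 1 := by
    refine Eq.trans ?_ hxy
    field_simp
  set y' := y / (1 - (k : ℝ)) with hy'
  -- The tangent at `(x, y)` is its polar `x X + y Y / (1 - k) = 1`, here divided by the length `N`
  -- of its normal.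
  refine ⟨{ cn := x / N, sn := y' / N, dn := 1 / N, cn_sq := ?_, dn_sq := ?_,
            dn_pos := by positivity }, fun q => ?_⟩
  · rw [div_pow, div_pow, eq_sub_iff_add_eq, ← add_div, ← hN2, div_self (by positivity)]
  · rw [div_pow, div_pow, eq_sub_iff_add_eq, ← mul_div_assoc, ← add_div,
      div_eq_one_iff_eq (by positivity), hN2]
    linear_combination -hxy'
  · have horth' : x * v1 + y' * v2 = 0 := by rw [← horth, hy']; ring
    have hyy : y' * y = y ^ 2 / (1 - k) := by rw [hy']; ring
    have hiff : x / N * majorCoord e s q + y' / N * minorCoord e s q = 1 / N ↔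
        x * majorCoord e s q + y' * minorCoord e s q = 1 := by
      rw [div_mul_eq_mul_div, div_mul_eq_mul_div, ← add_div, div_left_inj' hNpos.ne']
    rw [hiff, hline]
    constructor
    · rintro ⟨τ, rfl⟩
      rw [majorCoord_add_smul, minorCoord_add_smul]
      linear_combination τ * horth' + hxy + hyy
    · intro hq
      set X1 := majorCoord e s q with hX1
      set Y1 := minorCoord e s q with hY1
      have hdet : (X1 - x) * v2 - (Y1 - y) * v1 = 0 := by
        have ha : x * (X1 - x) + y' * (Y1 - y) = 0 := by linear_combination hq - hxy - hyy
        have hN' : x ^ 2 + y' ^ 2 ≠ 0 := hN.ne'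
        apply mul_left_cancel₀ hN'
        linear_combination (x * v2 - y' * v1) * ha + (y' * (X1 - x) - x * (Y1 - y)) * horth'
      refine ⟨((X1 - x) * v1 + (Y1 - y) * v2) / (v1 ^ 2 + v2 ^ 2), ext_coord he hs ?_ ?_⟩
      · rw [majorCoord_add_smul, ← hX1, ← hv1, ← hx]
        field_simp
        linear_combination v2 * hdet
      · rw [minorCoord_add_smul, ← hY1, ← hv2, ← hy]
        field_simp
        linear_combination (-v1) * hdet

/-- A line meets an ellipse in at most two points. -/
theorem eq_of_three_mem {e : Plane} (he : e 0 ^ 2 + e 1 ^ 2 = 1) {s : ℝ} (hs : 0 < s)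
    {k : Set.Ico (0 : ℝ) 1} (u : JacobiPoint k) {A B : ℝ} (hA : 0 < A) (hB : 0 < B)
    {q : Fin 3 → Plane}
    (hl : ∀ i, u.cn * majorCoord e s (q i) + u.sn * minorCoord e s (q i) = u.dn)
    (hC : ∀ i, majorCoord e s (q i) ^ 2 / A + minorCoord e s (q i) ^ 2 / B = 1) :
    q 0 = q 1 ∨ q 0 = q 2 ∨ q 1 = q 2 := by
  have hu := u.cn_sq
  obtain ⟨σ, hσ⟩ : ∃ σ : Fin 3 → ℝ, ∀ i, majorCoord e s (q i) = u.dn * u.cn - σ i * u.sn ∧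
      minorCoord e s (q i) = u.dn * u.sn + σ i * u.cn := by
    refine ⟨fun i => u.cn * minorCoord e s (q i) - u.sn * majorCoord e s (q i), fun i => ⟨?_, ?_⟩⟩
    · linear_combination u.cn * hl i - majorCoord e s (q i) * hu
    · linear_combination u.sn * hl i - minorCoord e s (q i) * hu
  have hinj : ∀ i j, σ i = σ j → q i = q j := fun i j hij =>
    ext_coord he hs (by rw [(hσ i).1, (hσ j).1, hij]) (by rw [(hσ i).2, (hσ j).2, hij])
  have hQ : 0 < u.sn ^ 2 / A + u.cn ^ 2 / B := by
    by_cases h0 : u.sn = 0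
    · rw [h0] at hu
      rw [h0, hu]
      norm_num
      exact hB
    · positivity
  -- Vieta: two distinct roots of the quadratic in `σ` have a prescribed sum.
  have hdiff : ∀ i j, σ i ≠ σ j → (u.sn ^ 2 / A + u.cn ^ 2 / B) * (σ i + σ j) =
      2 * u.dn * u.cn * u.sn * (1 / A - 1 / B) := by
    intro i j hij
    have h1 := hC i
    have h2 := hC j
    rw [(hσ i).1, (hσ i).2] at h1
    rw [(hσ j).1, (hσ j).2] at h2
    apply mul_left_cancel₀ (sub_ne_zero.2 hij)
    linear_combination h1 - h2
  by_cases h01 : σ 0 = σ 1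
  · exact Or.inl (hinj _ _ h01)
  by_cases h02 : σ 0 = σ 2
  · exact Or.inr (Or.inl (hinj _ _ h02))
  refine Or.inr (Or.inr (hinj _ _ ?_))
  have := mul_left_cancel₀ hQ.ne' ((hdiff 0 1 h01).trans (hdiff 0 2 h02).symm)
  linarith

/-! ### The sides of a Poncelet polygon form an arithmetic progression. -/

open JacobiPoint

variable {m : ℕ}

theorem two_ne_zero_of_three_le (hm : 3 ≤ m) : (2 : ZMod m) ≠ 0 := by
  intro h
  have h2 : ((2 : ℕ) : ZMod m) = 0 := by exact_mod_cast h
  have := Nat.le_of_dvd two_pos ((ZMod.natCast_eq_zero_iff 2 m).1 h2)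
  omega

theorem one_ne_zero_of_three_le (hm : 3 ≤ m) : (1 : ZMod m) ≠ 0 := by
  intro h
  exact two_ne_zero_of_three_le hm (by rw [← one_add_one_eq_two, h, add_zero])

section Polygon

variable {e : Plane} {s A B : ℝ} {k : Set.Ico (0 : ℝ) 1} {p : ZMod m → Plane}
  {u : ZMod m → JacobiPoint k}

/-- A side contains no vertices but its own two, so equal sides `i ≠ j` would give `j = i + 1` and
`i = j + 1`, impossible for `m ≥ 3`. -/
theorem side_injective (hm : 3 ≤ m) (he : e 0 ^ 2 + e 1 ^ 2 = 1) (hs : 0 < s) (hA : 0 < A)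
    (hB : 0 < B) (hp : Function.Injective p)
    (hC : ∀ i, majorCoord e s (p i) ^ 2 / A + minorCoord e s (p i) ^ 2 / B = 1)
    (hl : ∀ i, (u i).cn * majorCoord e s (p i) + (u i).sn * minorCoord e s (p i) = (u i).dn)
    (hr : ∀ i, (u i).cn * majorCoord e s (p (i + 1)) + (u i).sn * minorCoord e s (p (i + 1)) =
      (u i).dn) : Function.Injective u := by
  have key : ∀ i j : ZMod m, i ≠ j →
      (u i).cn * majorCoord e s (p j) + (u i).sn * minorCoord e s (p j) = (u i).dn →
      j = i + 1 := by
    intro i j hij h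
    have := eq_of_three_mem he hs (u i) hA hB (q := ![p i, p (i + 1), p j])
      (by intro n; fin_cases n; exacts [hl i, hr i, h])
      (by intro n; fin_cases n; exacts [hC i, hC _, hC j])
    rcases this with h1 | h1 | h1
    · exact absurd (left_eq_add.1 (hp h1)) (one_ne_zero_of_three_le hm)
    · exact absurd (hp h1) hij
    · exact (hp h1).symm
  intro i j hij
  by_contra hne
  have h1 : j = i + 1 := key i j hne (by rw [hij]; exact hl j)
  have h2 : i = j + 1 := key j i (Ne.symm hne) (by rw [← hij]; exact hl i)
  rw [h1, add_assoc, left_eq_add, one_add_one_eq_two] at h2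
  exact two_ne_zero_of_three_le hm h2

/-- Poncelet's map is a translation in Jacobi's parametrization of the tangent lines. -/
theorem exists_translation (hm : 3 ≤ m) {r : ℝ} (hr0 : 0 ≤ r) (hu : Function.Injective u)
    (hC : ∀ i, majorCoord e s (p i) ^ 2 / (1 + r) +
      minorCoord e s (p i) ^ 2 / (1 - k + r) = 1)
    (hl : ∀ i, (u i).cn * majorCoord e s (p i) + (u i).sn * minorCoord e s (p i) = (u i).dn)
    (hr : ∀ i, (u i).cn * majorCoord e s (p (i + 1)) + (u i).sn * minorCoord e s (p (i + 1)) =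
      (u i).dn) : ∃ w : JacobiPoint k, ∀ (i : ZMod m) (n : ℕ), u (i + n) = u i + n • w := by
  have : NeZero m := ⟨by omega⟩
  have hstep : ∀ i : ZMod m, ∃ w : JacobiPoint k, u (i + 1) = u i + (w + w) ∧
      w.sn ^ 2 = r / (1 - k + r) := by
    intro i
    have hne : u i ≠ u (i + 1) := fun h =>
      one_ne_zero_of_three_le hm (left_eq_add.1 (hu h))
    exact exists_half_sub_of_mem_confocal hne (hr i) (hl (i + 1)) hr0 (hC (i + 1))
  choose w hw hws using hstep
  have hconst : ∀ n : ℕ, u ((n : ZMod m) + 1) = u n + (w 0 + w 0) := by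
    intro n
    induction n with
    | zero => simpa using hw 0
    | succ n ih =>
      have h1 := hw ((n : ZMod m) + 1)
      push_cast
      -- The opposite sign would lead back from side `n + 1` to side `n`, making sides `n` and `n +
      -- 2` equal.
      rcases add_self_eq_or_eq_neg ((hws ((n : ZMod m) + 1)).trans (hws 0).symm) with h | h
      · rw [h1, h]
      · exfalso
        rw [h, ih, add_neg_cancel_right] at h1
        have h2 := hu h1
        rw [add_assoc, add_eq_left, one_add_one_eq_two] at h2
        exact two_ne_zero_of_three_le hm h2
  refine ⟨w 0 + w 0, fun i n => ?_⟩
  induction n with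
  | zero => simp
  | succ n ih =>
    have := hconst (i + n : ZMod m).val
    rw [ZMod.natCast_zmod_val, ih] at this
    push_cast
    rw [← add_assoc, this, succ_nsmul, add_assoc]

end Polygon

/-! ### The incentre of four tangent lines. -/

theorem exists_half_of_add_self_ne_zero {k : Set.Ico (0 : ℝ) 1} {v : JacobiPoint k}
    (h : v + v ≠ 0) : ∃ w : JacobiPoint k, w + w = v ∧ 0 < w.cn ∧ w.sn ≠ 0 := by
  have hs := sn_ne_zero_of_add_self_ne_zero h
  have hc : v.cn ≠ -1 := by
    intro hc
    have := v.cn_sq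
    rw [hc] at this
    exact hs (pow_eq_zero_iff two_ne_zero |>.1 (by linarith))
  obtain ⟨w, hw, hwc⟩ := exists_half hc
  refine ⟨w, hw, hwc, sn_ne_zero_of_add_self_ne_zero fun h0 => h ?_⟩
  rw [← hw, h0, add_zero]

/-- The unit normal of the tangent line with argument `u`. -/
noncomputable def normal (e : Plane) {k : Set.Ico (0 : ℝ) 1} (u : JacobiPoint k) : Plane :=
  !₂[u.cn * e 0 - u.sn * e 1, u.cn * e 1 + u.sn * e 0]

theorem isNormalForm_normal {e : Plane} (he : e 0 ^ 2 + e 1 ^ 2 = 1) {s : ℝ} (hs : 0 < s)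
    {k : Set.Ico (0 : ℝ) 1} {u : JacobiPoint k} {l : AffineSubspace ℝ Plane}
    (hl : ∀ q, q ∈ l ↔ u.cn * majorCoord e s q + u.sn * minorCoord e s q = u.dn) :
    IsNormalForm l (normal e u) (s * u.dn) := by
  refine ⟨?_, mul_pos hs u.dn_pos, fun q => ?_⟩
  · simp only [normal, Matrix.cons_val]
    linear_combination u.cn_sq + (u.cn ^ 2 + u.sn ^ 2) * he
  · rw [hl, majorCoord, minorCoord, ← mul_div_assoc, ← mul_div_assoc, ← add_div,
      div_eq_iff hs.ne']
    simp only [normal, Matrix.cons_val]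
    constructor <;> intro h <;> linarith

/-- The non-torsion hypotheses do two jobs: they allow halving `x` and `y`, and they make `sn` of
the halves nonzero, so that `ρ ≠ 0`. -/
theorem exists_signed_dist {e : Plane} (he : e 0 ^ 2 + e 1 ^ 2 = 1) {s : ℝ} (hs : 0 < s)
    {k : Set.Ico (0 : ℝ) 1} (v : JacobiPoint k) {x y : JacobiPoint k} (hx : x + x ≠ 0)
    (hy : y + y ≠ 0) :
    ∃ (o : Plane) (ρ : ℝ), ρ ≠ 0 ∧
      s * v.dn - (normal e v 0 * o 0 + normal e v 1 * o 1) = ρ ∧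
      s * (v + x).dn - (normal e (v + x) 0 * o 0 + normal e (v + x) 1 * o 1) = -ρ ∧
      s * (v + y).dn - (normal e (v + y) 0 * o 0 + normal e (v + y) 1 * o 1) = -ρ ∧
      s * (v + x + y).dn -
        (normal e (v + x + y) 0 * o 0 + normal e (v + x + y) 1 * o 1) = ρ := by
  obtain ⟨a, rfl, hac, has⟩ := exists_half_of_add_self_ne_zero hx
  obtain ⟨b, rfl, hbc, hbs⟩ := exists_half_of_add_self_ne_zero hy
  obtain ⟨z, rfl⟩ : ∃ z, v = z + (-a + -b) := ⟨v + a + b, by abel⟩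
  have hk : 0 < 1 - (k : ℝ) := sub_pos.2 k.2.2
  have hz := z.dn_pos
  set M := z.dn * (a.cn * b.cn) with hM
  have hMpos : 0 < M := by positivity
  set X := a.dn * b.dn * z.cn / M with hX
  set Y := (1 - k) * z.sn / M with hY
  -- Used for `a' = ±a`, `b' = ±b`: the centre `(X, Y)` is common to all four lines, and only `a'.sn
  -- * b'.sn` changes sign.
  have main : ∀ a' b' : JacobiPoint k, a'.cn = a.cn → a'.dn = a.dn → b'.cn = b.cn →
      b'.dn = b.dn → ∀ n : JacobiPoint k, n = z + (a' + b') →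
      s * n.dn - (normal e n 0 * (s * (e 0 * X - e 1 * Y)) +
        normal e n 1 * (s * (e 1 * X + e 0 * Y))) = s * ((1 - k) * a'.sn * b'.sn / M) := by
    rintro a' b' h1 h2 h3 h4 n rfl
    have h := contact_relation z a' b'
    rw [h1, h2, h3, h4, ← hM] at h
    generalize z + (a' + b') = n at h ⊢
    have h' : X * n.cn + Y * n.sn + (1 - k) * a'.sn * b'.sn / M = n.dn := by
      rw [hX, hY]
      field_simp
      linarith
    simp only [normal, Matrix.cons_val]
    linear_combination (-s) * h' - s * (X * n.cn + Y * n.sn) * he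
  refine ⟨!₂[s * (e 0 * X - e 1 * Y), s * (e 1 * X + e 0 * Y)],
    s * ((1 - k) * a.sn * b.sn / M), ?_, ?_, ?_, ?_, ?_⟩
  · exact mul_ne_zero hs.ne'
      (div_ne_zero (mul_ne_zero (mul_ne_zero hk.ne' has) hbs) hMpos.ne')
  · refine (main (-a) (-b) rfl rfl rfl rfl _ rfl).trans ?_
    simp only [sn_neg]; ring
  · refine (main a (-b) rfl rfl rfl rfl _ (by abel)).trans ?_
    simp only [sn_neg]; ring
  · refine (main (-a) b rfl rfl rfl rfl _ (by abel)).trans ?_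
    simp only [sn_neg]; ring
  · exact main a b rfl rfl rfl rfl _ (by abel)

end PonceletGrid

open PonceletGrid in
theorem mainTheorem8 (m : ℕ) (hm : 3 ≤ m)
    (f : PonceletGrid.Plane) (s t : ℝ) (hs : ‖f‖ < s) (hst : s < t)
    (p : ZMod m → PonceletGrid.Plane)
    (hp : PonceletGrid.IsPonceletPolygon (PonceletGrid.ellipse f s) (PonceletGrid.ellipse f t) p)
    (a b k : ZMod m) (hk : 2 * k ≠ 0) (hab : 2 * (b - a) ≠ 0) :
    ∃ S : EuclideanGeometry.Sphere PonceletGrid.Plane,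
      PonceletGrid.IsIncircle (PonceletGrid.side p) a b (a + k) (b + k) S := by
  have : NeZero m := ⟨by omega⟩
  obtain ⟨e, he, hf⟩ := exists_unit_eq_norm_smul f
  have hc := norm_nonneg f
  have hs0 : 0 < s := hc.trans_lt hs
  have ht0 : 0 < t := hs0.trans hst
  obtain ⟨κ, hκ⟩ : ∃ κ : Set.Ico (0 : ℝ) 1, (κ : ℝ) = ‖f‖ ^ 2 / s ^ 2 :=
    ⟨⟨‖f‖ ^ 2 / s ^ 2, by positivity, by
      rw [div_lt_one (by positivity)]; exact pow_lt_pow_left₀ hs hc two_ne_zero⟩, rfl⟩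
  have hb : (s ^ 2 - ‖f‖ ^ 2) / s ^ 2 = 1 - κ := by rw [hκ]; field_simp
  have hκ1 : 0 < 1 - (κ : ℝ) := sub_pos.2 κ.2.2
  -- The confocal parameter of the outer ellipse, in units where the inner semi-major axis is 1.
  set r := (t ^ 2 - s ^ 2) / s ^ 2 with hr
  have hr0 : 0 < r := div_pos (sub_pos.2 (pow_lt_pow_left₀ hst hs0.le two_ne_zero)) (by positivity)
  have hr1 : t ^ 2 / s ^ 2 = 1 + r := by rw [hr]; field_simp; ring
  have hr2 : (t ^ 2 - ‖f‖ ^ 2) / s ^ 2 = 1 - κ + r := by rw [hr, hκ]; field_simp; ring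
  have hX : ∀ q, q ∈ ellipse f s ↔
      majorCoord e s q ^ 2 + minorCoord e s q ^ 2 / (1 - κ) = 1 := by
    intro q
    have := mem_ellipse_iff he hc hs0 hs q
    rwa [← hf, hb, div_self (by positivity), div_one] at this
  have hC : ∀ i, majorCoord e s (p i) ^ 2 / (1 + r) +
      minorCoord e s (p i) ^ 2 / (1 - κ + r) = 1 := by
    intro i
    have := mem_ellipse_iff he hc hs0 (hs.trans hst) (p i)
    rw [← hf, hr1, hr2] at this
    exact this.1 (hp.mem i)
  have hne : ∀ i, p i ≠ p (i + 1) := fun i h =>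
    one_ne_zero_of_three_le hm (left_eq_add.1 (hp.injective h))
  choose u hu using fun i => exists_jacobiPoint_of_tangent he hs0 hX (hne i) (hp.tangent i)
  have hl := fun i => (hu i (p i)).1 (left_mem_affineSpan_pair ℝ _ _)
  have hrt := fun i => (hu i (p (i + 1))).1 (right_mem_affineSpan_pair ℝ _ _)
  have hinj : Function.Injective u := side_injective hm he hs0 (by positivity) (by positivity)
    hp.injective hC hl hrt
  obtain ⟨w, hw⟩ := exists_translation hm hr0.le hinj hC hl hrt
  have hw' : ∀ i j : ZMod m, u (i + j) = u i + j.val • w := by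
    intro i j
    rw [← hw, ZMod.natCast_zmod_val]
  -- Injectivity of `u` turns the index condition `2 * j ≠ 0` into the condition that the shift
  -- `j.val • w` is not 2-torsion.
  have hval : ∀ j : ZMod m, 2 * j ≠ 0 → j.val • w + j.val • w ≠ 0 := by
    intro j hj h0
    apply hj
    have h1 : u (0 + j + j) = u 0 := by rw [hw', hw', add_assoc, h0, add_zero]
    have h2 := hinj h1
    rw [zero_add] at h2
    rw [two_mul, h2]
  obtain ⟨o, ρ, hρ, h1, h2, h3, h4⟩ :=
    exists_signed_dist he hs0 (u a) (hval _ hab) (hval _ hk)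
  have eb : u b = u a + (b - a).val • w := by rw [← hw', add_sub_cancel]
  refine exists_isIncircle (n := fun i => normal e (u i)) (h := fun i => s * (u i).dn)
    (fun i => isNormalForm_normal he hs0 (hu i)) hρ h1 ?_ ?_ ?_
  · simpa only [eb] using h2
  · simpa only [hw'] using h3
  · simpa only [hw', eb] using h4
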